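/- A (right) near-ring is a set $N$ with a (not necessarily commutative) group operation $+$ and an associative multiplication such that $(a+b)c=ac+bc$ for all $a,b,c\in N$; it is zero-symmetric if $n0=0$ for all $n\in N$, and it is a ring if $+$ is commutative and also $a(b+c)=ab+ac$ for all $a,b,c\in N$ (no identity is required). An $N$-group is a (not necessarily commutative) group $(\Gamma,+)$ with an action of $N$ such that $(m+n)\gamma=m\gamma+n\gamma$ and $(mn)\gamma=m(n\gamma)$ for all $m,n\in N$, $\gamma\in\Gamma$. It is faithful if $n\Gamma=\{0\}$ implies $n=0$, and it is of type $2$ if $N\Gamma\neq\{0\}$ and the only subgroups $K$ of $\Gamma$ with $NK\subseteq K$ are $\{0\}$ and $\Gamma$. A near-ring $N$ is $2$-primitive if it has a faithful $N$-group of type $2$. **Theorem 4.4.** Let $N$ be a zero-symmetric near-ring that is not a ring. Then the following are equivalent: (1) $N$ is $2$-primitive. (2) There exist (a) a group $(\Gamma,+)$ (not necessarily commutative) with zero element $0$, (b) a set $X=\{0\}\cup X_1\subseteq\Gamma$ with $X_1\neq\emptyset$ and $0\notin X_1$, (c) a subgroup $S\leq\mathrm{Aut}(\Gamma,+)$ with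 $S(X)\subseteq X$, acting without fixed points on $X_1$ (that is, if $s\in S$, $x\in X_1$ and $s(x)=x$, then $s=\mathrm{id}$), (d) a function $\phi:\Gamma\to X$ with $\phi|_X=\mathrm{id}$, $\phi(0)=0$ and $\phi(s(\gamma))=s(\phi(\gamma))$ for all $\gamma\in\Gamma$, $s\in S$, such that $\Gamma_0:=\{\gamma\in\Gamma\mid\phi(\gamma)=0\}$ contains no subgroup of $\Gamma$ other than $\{0\}$, and such that $N$ is isomorphic to a dense subnear-ring $M_S$ of the sandwich centralizer near-ring $$M_0(X,\Gamma,\phi,S):=\{f:X\to\Gamma\mid f(0)=0\ \text{and}\ f(s(x))=s(f(x))\ \text{for all } s\in S,\ x\in X\},$$ whose operations are pointwise addition and the sandwich multiplication $f\circ' g:=f\circ\phi\circ g$. Here $M_S$ is dense if for all $k\in\mathbb N$, all $x_1,\dots,x_k\in X$ and all $g\in M_0(X,\Gamma,\phi,S)$ there is an $f\in M_S$ with $f(x_i)=g(x_i)$ for $i=1,\dots,k$. -/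

import Mathlib

universe u

/-- A right near-ring: a (not necessarily commutative) group under addition, a semigroup under
multiplication, satisfying the right distributive law. No identity element is required. -/
class NearRing (N : Type*) extends AddGroup N, Semigroup N where
  /-- The right distributive law. -/
  right_distrib : ∀ a b c : N, (a + b) * c = a * c + b * c

namespace NearRing

/-- `N` is zero-symmetric if `n * 0 = 0` for all `n` (the law `0 * n = 0` is automatic). -/
def IsZeroSymmetric (N : Type*) [NearRing N] : Prop :=
  ∀ n : N, n * 0 = 0

/-- The near-ring `N` is a (not necessarily unital) ring: addition is commutative and the left
distributive law holds as well. -/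
def IsRing (N : Type*) [NearRing N] : Prop :=
  (∀ a b : N, a + b = b + a) ∧ ∀ a b c : N, a * (b + c) = a * b + a * c

end NearRing

/-- An `N`-group: a (not necessarily commutative) additive group `Γ` with an action of `N` such
that `(m + n)γ = mγ + nγ` and `(mn)γ = m(nγ)`. -/
class NGroup (N : Type*) (Γ : Type*) [NearRing N] [AddGroup Γ] extends SMul N Γ where
  add_smul : ∀ (m n : N) (γ : Γ), (m + n) • γ = m • γ + n • γ
  mul_smul : ∀ (m n : N) (γ : Γ), (m * n) • γ = m • (n • γ)

namespace NGroup

/-- A subgroup `K` of `Γ` is an `N`-subgroup if `NK ⊆ K`. -/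
def IsNSubgroup (N : Type*) {Γ : Type*} [NearRing N] [AddGroup Γ] [NGroup N Γ]
    (K : AddSubgroup Γ) : Prop :=
  ∀ n : N, ∀ k ∈ K, n • k ∈ K

/-- `Γ` is faithful: the annihilator of `Γ` is zero. -/
def IsFaithful (N : Type*) (Γ : Type*) [NearRing N] [AddGroup Γ] [NGroup N Γ] : Prop :=
  ∀ n : N, (∀ γ : Γ, n • γ = 0) → n = 0

/-- `Γ` is of type 2: `NΓ ≠ {0}`, and the only `N`-subgroups of `Γ` are `{0}` and `Γ`. -/
def IsTypeTwo (N : Type*) (Γ : Type*) [NearRing N] [AddGroup Γ] [NGroup N Γ] : Prop :=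
  (∃ (n : N) (γ : Γ), n • γ ≠ 0) ∧
    ∀ K : AddSubgroup Γ, IsNSubgroup N K → K = ⊥ ∨ K = ⊤

end NGroup

/-- `N` is 2-primitive if it acts on some faithful `N`-group of type 2. (For a zero-symmetric `N`
such a group `Γ` is of the form `Nγ`, so that it costs nothing to take it in the universe of
`N`.) -/
def NearRing.IsTwoPrimitive (N : Type u) [NearRing N] : Prop :=
  ∃ (Γ : Type u) (_ : AddGroup Γ) (_ : NGroup N Γ),
    NGroup.IsFaithful N Γ ∧ NGroup.IsTypeTwo N Γ

/-- A subnear-ring: an additive subgroup closed under multiplication. -/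
structure SubNearRing (N : Type*) [NearRing N] extends AddSubgroup N where
  mul_mem' : ∀ {a b : N}, a ∈ carrier → b ∈ carrier → a * b ∈ carrier

namespace SubNearRing

variable {N : Type*} [NearRing N]

/-- The near-ring structure that a subnear-ring inherits. -/
instance instNearRing (M : SubNearRing N) : NearRing M.toAddSubgroup where
  mul a b := ⟨a.1 * b.1, M.mul_mem' a.2 b.2⟩
  mul_assoc a b c := Subtype.ext (mul_assoc a.1 b.1 c.1)
  right_distrib a b c := Subtype.ext (NearRing.right_distrib a.1 b.1 c.1)

end SubNearRing

/-- The data from which a sandwich centralizer near-ring on the group `Γ` is built: a subset `X`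
containing `0`, a sandwich function `φ : Γ → X` with `φ(0) = 0`, and a group `S` of automorphisms
of `Γ` which maps `X` into `X` and commutes with `φ`. -/
structure SandwichData (Γ : Type*) [AddGroup Γ] where
  /-- The domain of the functions in the near-ring. -/
  X : Set Γ
  /-- The sandwich function. -/
  φ : Γ → X
  /-- The group of automorphisms (Mathlib writes composition in `AddAut Γ` as addition). -/
  S : AddSubgroup (AddAut Γ)
  zero_mem : (0 : Γ) ∈ X
  φ_zero : (φ 0 : Γ) = 0
  S_mem : ∀ s ∈ S, ∀ x ∈ X, s x ∈ X
  φ_comm : ∀ s ∈ S, ∀ γ : Γ, (φ (s γ) : Γ) = s (φ γ : Γ)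

namespace SandwichData

variable {Γ : Type*} [AddGroup Γ]

/-- The sandwich centralizer near-ring `M₀(X, Γ, φ, S)`: the functions `f : X → Γ` with
`f(0) = 0` and `f(s(x)) = s(f(x))` for all `s ∈ S` and `x ∈ X`. -/
@[ext]
structure CentralizerNearRing (D : SandwichData Γ) where
  /-- The underlying function. -/
  toFun : D.X → Γ
  map_zero' : toFun ⟨0, D.zero_mem⟩ = 0
  map_S' : ∀ (s : AddAut Γ) (hs : s ∈ D.S) (x : D.X),
    toFun ⟨s x.1, D.S_mem s hs x.1 x.2⟩ = s (toFun x)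

namespace CentralizerNearRing

variable {D : SandwichData Γ}

instance : CoeFun D.CentralizerNearRing (fun _ => D.X → Γ) := ⟨toFun⟩

/-- Pointwise addition. -/
instance : Add D.CentralizerNearRing where
  add f g :=
    { toFun := fun x => f x + g x
      map_zero' := by rw [f.map_zero', g.map_zero', add_zero]
      map_S' := fun s hs x => by rw [f.map_S' s hs, g.map_S' s hs, map_add] }

/-- The zero function. -/
instance : Zero D.CentralizerNearRing where
  zero :=
    { toFun := fun _ => 0
      map_zero' := rfl
      map_S' := fun s _ _ => (map_zero s).symm }

/-- Pointwise negation. -/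
instance : Neg D.CentralizerNearRing where
  neg f :=
    { toFun := fun x => -f x
      map_zero' := by rw [f.map_zero', neg_zero]
      map_S' := fun s hs x => by rw [f.map_S' s hs, map_neg] }

/-- Sandwich multiplication `f ∘ φ ∘ g`. -/
instance : Mul D.CentralizerNearRing where
  mul f g :=
    { toFun := fun x => f (D.φ (g x))
      map_zero' := by
        have h : D.φ 0 = ⟨0, D.zero_mem⟩ := Subtype.ext D.φ_zero
        rw [g.map_zero', h, f.map_zero']
      map_S' := fun s hs x => by
        have h : D.φ (s (g x)) = ⟨s (D.φ (g x)).1, D.S_mem s hs _ (D.φ (g x)).2⟩ :=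
          Subtype.ext (D.φ_comm s hs (g x))
        rw [g.map_S' s hs, h, f.map_S' s hs] }

instance : NearRing D.CentralizerNearRing where
  add_assoc f g h := CentralizerNearRing.ext (funext fun x => add_assoc (f x) (g x) (h x))
  zero_add f := CentralizerNearRing.ext (funext fun x => zero_add (f x))
  add_zero f := CentralizerNearRing.ext (funext fun x => add_zero (f x))
  neg_add_cancel f := CentralizerNearRing.ext (funext fun x => neg_add_cancel (f x))
  nsmul := nsmulRec
  zsmul := zsmulRec
  mul_assoc _ _ _ := rfl
  right_distrib _ _ _ := rfl

end CentralizerNearRing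

/-- A subnear-ring `M` of `M₀(X, Γ, φ, S)` is dense if every element of `M₀(X, Γ, φ, S)` agrees
at any finitely many given points of `X` with some element of `M`. -/
def IsDense (D : SandwichData Γ) (M : SubNearRing D.CentralizerNearRing) : Prop :=
  ∀ (k : ℕ) (x : Fin k → D.X) (g : D.CentralizerNearRing),
    ∃ f ∈ M.toAddSubgroup, ∀ i, f (x i) = g (x i)

/-- The set `Γ₀` of the elements `γ` of `Γ` with `φ(γ) = 0`. -/
def kernelSet (D : SandwichData Γ) : Set Γ :=
  {γ | (D.φ γ : Γ) = 0}

/-- The group `S` acts without fixed points on `Y`: only the identity fixes an element of `Y`. -/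
def ActsWithoutFixedPointsOn (D : SandwichData Γ) (Y : Set Γ) : Prop :=
  ∀ s ∈ D.S, ∀ y ∈ Y, s y = y → s = AddEquiv.refl Γ

end SandwichData

/-!
A sandwich centralizer near-ring acts on its group through `f • γ = f (φ γ)`. Since `S` acts
freely on `X \ {0}`, an `S`-equivariant function with `f 0 = 0` may take any prescribed value at a
nonzero point of `X`. By density, an element `γ` with `φ γ ≠ 0` therefore generates `Γ` under a
dense subnear-ring, and a nontrivial subgroup always has such an element. So `Γ` is of type 2.

Conversely, let `Γ` be a faithful `N`-group of type 2, and let `S` be the group of its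
`N`-automorphisms. Call two elements of `Γ` indistinguishable if every `n` acts equally on both.
An element of `S` that maps `γ` with `N γ ≠ 0` to an indistinguishable element is the identity,
because `N γ = Γ`. Hence `S` acts freely on the indistinguishability classes outside the class of
`0`, and representatives of these classes can be chosen `S`-equivariantly
(`NGroup.exists_equivariant_representative`); `φ` maps an element to its representative, and `n`
becomes the function `x ↦ n • x` on the set `X` of representatives.

Density of the image is the Jacobson-type density theorem. It has two ingredients. First, if the
annihilator of `t` is contained in that of `x`, where `N x ≠ 0`, then `n • t ↦ n • x` is an
`N`-automorphism (`NGroup.exists_aut_of_ann_le`), so that `t` and `x` lie in one `S`-orbit up to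
indistinguishability. Secondly, if `N` is not a ring, then an annihilator `Ann x` that contains
neither of two intersections of annihilators does not contain their intersection
(`NGroup.exists_ann_ann_smul_ne_zero`): otherwise any two elements of `Γ` would be of the form
`a • x`, `b • x` with `a`, `b` in the two intersections, and the commutator of `a` and `b`, as well
as `n * (a + b) - n * b - n * a`, would annihilate `x`. That makes `Γ` commutative with `N` acting
by endomorphisms, and by faithfulness `N` would be a ring.
-/

namespace NGroup

variable {N Γ : Type*} [NearRing N] [AddGroup Γ] [NGroup N Γ]

/-! ### Elementary facts on `N`-groups -/

theorem zero_smul_eq (γ : Γ) : (0 : N) • γ = 0 := by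
  have h := NGroup.add_smul (0 : N) 0 γ
  rw [add_zero] at h
  exact left_eq_add.mp h

theorem neg_smul_eq (n : N) (γ : Γ) : (-n) • γ = -(n • γ) := by
  refine eq_neg_of_add_eq_zero_left ?_
  rw [← NGroup.add_smul, neg_add_cancel, zero_smul_eq]

theorem smul_zero_eq (hzs : NearRing.IsZeroSymmetric N) (n : N) : n • (0 : Γ) = 0 := by
  rw [← zero_smul_eq (N := N) (0 : Γ), ← NGroup.mul_smul, hzs n]

/-- If `I` is a left-invariant subgroup of `N`, then `I x` is an `N`-subgroup, so it is all of `Γ` as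
soon as it is nonzero. -/
theorem IsTypeTwo.exists_mem_smul_eq (h2 : IsTypeTwo N Γ) (I : AddSubgroup N)
    (hI : ∀ n : N, ∀ a ∈ I, n * a ∈ I) {x : Γ} (hx : ∃ a ∈ I, a • x ≠ 0) (γ : Γ) :
    ∃ a ∈ I, a • x = γ := by
  let K : AddSubgroup Γ :=
    { carrier := {γ | ∃ a ∈ I, a • x = γ}
      zero_mem' := ⟨0, I.zero_mem, zero_smul_eq x⟩
      add_mem' := by
        rintro _ _ ⟨a, ha, rfl⟩ ⟨b, hb, rfl⟩
        exact ⟨a + b, I.add_mem ha hb, NGroup.add_smul a b x⟩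
      neg_mem' := by
        rintro _ ⟨a, ha, rfl⟩
        exact ⟨-a, I.neg_mem ha, neg_smul_eq a x⟩ }
  have hK : IsNSubgroup N K := by
    rintro n _ ⟨a, ha, rfl⟩
    exact ⟨n * a, hI n a ha, NGroup.mul_smul n a x⟩
  rcases h2.2 K hK with h | h
  · obtain ⟨a, ha, hax⟩ := hx
    have : a • x ∈ K := ⟨a, ha, rfl⟩
    rw [h, AddSubgroup.mem_bot] at this
    exact absurd this hax
  · have : γ ∈ K := h ▸ AddSubgroup.mem_top γ
    exact this

theorem IsTypeTwo.exists_smul_eq (h2 : IsTypeTwo N Γ) {x : Γ} (hx : ∃ a : N, a • x ≠ 0) (γ : Γ) :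
    ∃ a : N, a • x = γ := by
  obtain ⟨a, ha⟩ := hx
  obtain ⟨b, -, hb⟩ := h2.exists_mem_smul_eq ⊤ (fun _ _ _ => AddSubgroup.mem_top _)
    ⟨a, AddSubgroup.mem_top a, ha⟩ γ
  exact ⟨b, hb⟩

/-- The annihilator in `N` of a set `T` of elements of an `N`-group. -/
def ann (N : Type*) {Γ : Type*} [NearRing N] [AddGroup Γ] [NGroup N Γ] (T : Set Γ) :
    AddSubgroup N where
  carrier := {a | ∀ t ∈ T, a • t = 0}
  zero_mem' t _ := zero_smul_eq t
  add_mem' ha hb t ht := by rw [NGroup.add_smul, ha t ht, hb t ht, add_zero]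
  neg_mem' ha t ht := by rw [neg_smul_eq, ha t ht, neg_zero]

theorem mem_ann {T : Set Γ} {a : N} : a ∈ ann N T ↔ ∀ t ∈ T, a • t = 0 := Iff.rfl

theorem mul_mem_ann (hzs : NearRing.IsZeroSymmetric N) (T : Set Γ) (n a : N) (ha : a ∈ ann N T) :
    n * a ∈ ann N T := fun t ht => by
  rw [NGroup.mul_smul, ha t ht, smul_zero_eq hzs]

/-! ### Separation by annihilators -/

theorem IsFaithful.eq_of_smul_eq (hf : IsFaithful N Γ) {m n : N} (h : ∀ γ : Γ, m • γ = n • γ) :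
    m = n := by
  rw [← add_neg_eq_zero]
  refine hf _ fun γ => ?_
  rw [NGroup.add_smul, neg_smul_eq, h, add_neg_cancel]

theorem IsFaithful.isRing (hf : IsFaithful N Γ) (hcomm : ∀ α β : Γ, α + β = β + α)
    (hadd : ∀ (n : N) (α β : Γ), n • (α + β) = n • α + n • β) : NearRing.IsRing N := by
  refine ⟨fun a b => hf.eq_of_smul_eq fun γ => ?_, fun a b c => hf.eq_of_smul_eq fun γ => ?_⟩
  · rw [NGroup.add_smul, NGroup.add_smul, hcomm]
  · rw [NGroup.mul_smul, NGroup.add_smul, NGroup.add_smul, NGroup.mul_smul, NGroup.mul_smul, hadd]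

/-- The only step that needs `N` not to be a ring. The congruences modulo `Ann (T ∪ U)` between
`a + b` and `b + a`, and between `n * (a + b)` and `n * a + n * b`, for `a ∈ Ann T` and
`b ∈ Ann U`, would transfer to all of `Γ` through evaluation at `x`. -/
theorem exists_ann_ann_smul_ne_zero (hzs : NearRing.IsZeroSymmetric N)
    (hnr : ¬ NearRing.IsRing N) (hf : IsFaithful N Γ) (h2 : IsTypeTwo N Γ) {T U : Set Γ} {x : Γ}
    (hT : ∃ a ∈ ann N T, a • x ≠ 0) (hU : ∃ b ∈ ann N U, b • x ≠ 0) :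
    ∃ c ∈ ann N (T ∪ U), c • x ≠ 0 := by
  by_contra! hc
  have key : ∀ α β : Γ, ∃ a ∈ ann N T, ∃ b ∈ ann N U, a • x = α ∧ b • x = β := fun α β => by
    obtain ⟨a, ha, hax⟩ := h2.exists_mem_smul_eq _ (mul_mem_ann hzs T) hT α
    obtain ⟨b, hb, hbx⟩ := h2.exists_mem_smul_eq _ (mul_mem_ann hzs U) hU β
    exact ⟨a, ha, b, hb, hax, hbx⟩
  refine hnr (hf.isRing (fun α β => ?_) fun n α β => ?_)
  · obtain ⟨a, ha, b, hb, rfl, rfl⟩ := key α β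
    have h := hc (a + b + -(b + a)) fun t ht => by
      rw [NGroup.add_smul, neg_smul_eq, NGroup.add_smul, NGroup.add_smul]
      rcases ht with ht | ht
      · rw [ha t ht]; simp
      · rw [hb t ht]; simp
    rwa [NGroup.add_smul, neg_smul_eq, NGroup.add_smul, NGroup.add_smul, add_neg_eq_zero] at h
  · obtain ⟨a, ha, b, hb, rfl, rfl⟩ := key α β
    have h := hc (n * (a + b) + -(n * a + n * b)) fun t ht => by
      rw [NGroup.add_smul, neg_smul_eq, NGroup.add_smul, NGroup.mul_smul, NGroup.mul_smul,
        NGroup.mul_smul, NGroup.add_smul]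
      rcases ht with ht | ht
      · rw [ha t ht, smul_zero_eq hzs]; simp
      · rw [hb t ht, smul_zero_eq hzs]; simp
    rwa [NGroup.add_smul, neg_smul_eq, NGroup.add_smul, NGroup.mul_smul, NGroup.mul_smul,
      NGroup.mul_smul, NGroup.add_smul, add_neg_eq_zero] at h

theorem exists_ann_finset_smul_ne_zero (hzs : NearRing.IsZeroSymmetric N)
    (hnr : ¬ NearRing.IsRing N) (hf : IsFaithful N Γ) (h2 : IsTypeTwo N Γ) {x : Γ}
    (hx : ∃ a : N, a • x ≠ 0) (T : Finset Γ) (hT : ∀ t ∈ T, ∃ a : N, a • t = 0 ∧ a • x ≠ 0) :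
    ∃ a ∈ ann N (T : Set Γ), a • x ≠ 0 := by
  classical
  induction T using Finset.induction_on with
  | empty =>
    obtain ⟨a, ha⟩ := hx
    exact ⟨a, fun t ht => by simp at ht, ha⟩
  | insert t T _ ih =>
    obtain ⟨a, hat, hax⟩ := hT t (Finset.mem_insert_self t T)
    rw [Finset.coe_insert, Set.insert_eq]
    refine exists_ann_ann_smul_ne_zero hzs hnr hf h2 ⟨a, ?_, hax⟩
      (ih fun u hu => hT u (Finset.mem_insert_of_mem hu))
    rintro _ rfl
    exact hat

/-! ### Automorphisms of `N`-groups -/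

/-- The group of `N`-automorphisms of `Γ`, that is, of the automorphisms of the group `Γ` that
commute with the action of `N`. -/
def aut (N Γ : Type*) [NearRing N] [AddGroup Γ] [NGroup N Γ] : AddSubgroup (AddAut Γ) where
  carrier := {s | ∀ (n : N) (γ : Γ), s (n • γ) = n • s γ}
  zero_mem' _ _ := rfl
  add_mem' {s t} hs ht n γ := by
    change s (t (n • γ)) = n • s (t γ)
    rw [ht, hs]
  neg_mem' {s} hs n γ := by
    change s.symm (n • γ) = n • s.symm γ
    rw [AddEquiv.symm_apply_eq, hs, AddEquiv.apply_symm_apply]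

theorem mem_aut {s : AddAut Γ} : s ∈ aut N Γ ↔ ∀ (n : N) (γ : Γ), s (n • γ) = n • s γ := Iff.rfl

theorem IsTypeTwo.aut_eq (h2 : IsTypeTwo N Γ) {s t : AddAut Γ} {γ : Γ}
    (hγ : ∃ a : N, a • γ ≠ 0) (h : ∀ n : N, s (n • γ) = t (n • γ)) : s = t := by
  refine AddEquiv.ext fun δ => ?_
  obtain ⟨a, rfl⟩ := h2.exists_smul_eq hγ δ
  exact h a

/-- Inclusion of annihilators forces an `N`-automorphism `n • t ↦ n • x`. It need not map `t` to `x`,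
since `N` may lack an identity. -/
theorem exists_aut_of_ann_le (hzs : NearRing.IsZeroSymmetric N) (h2 : IsTypeTwo N Γ) {t x : Γ}
    (hx : ∃ a : N, a • x ≠ 0) (h : ∀ a : N, a • t = 0 → a • x = 0) :
    ∃ s ∈ aut N Γ, ∀ n : N, s (n • t) = n • x := by
  have ht : ∃ a : N, a • t ≠ 0 := by
    obtain ⟨a, ha⟩ := hx
    exact ⟨a, fun h0 => ha (h a h0)⟩
  have hwd : ∀ a b : N, a • t = b • t → a • x = b • x := fun a b hab => by
    have := h (a + -b) (by rw [NGroup.add_smul, neg_smul_eq, hab, add_neg_cancel])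
    rwa [NGroup.add_smul, neg_smul_eq, add_neg_eq_zero] at this
  -- The reverse inclusion of annihilators: otherwise `Ann x` maps `t` onto all of `Γ`, so that
  -- `N = Ann x + Ann t` annihilates `x`.
  have h' : ∀ a : N, a • x = 0 → a • t = 0 := by
    by_contra! hne
    obtain ⟨a, hax, hat⟩ := hne
    obtain ⟨b, hb⟩ := hx
    obtain ⟨c, hc, hct⟩ := h2.exists_mem_smul_eq (ann N {x}) (mul_mem_ann hzs _)
      ⟨a, fun y hy => by rw [Set.mem_singleton_iff.mp hy, hax], hat⟩ (b • t)
    exact hb ((hwd c b hct).symm.trans (hc x rfl))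
  choose c hc using fun γ => h2.exists_smul_eq ht γ
  have hcx : ∀ n : N, c (n • t) • x = n • x := fun n => hwd _ _ (hc _)
  let f : Γ →+ Γ := AddMonoidHom.mk' (fun γ => c γ • x) fun α β => by
    rw [← NGroup.add_smul]
    exact hwd _ _ (by rw [NGroup.add_smul, hc, hc, hc])
  have hinj : Function.Injective f := (injective_iff_map_eq_zero f).mpr fun γ hγ =>
    (hc γ).symm.trans (h' _ hγ)
  have hsurj : Function.Surjective f := fun γ => by
    obtain ⟨a, rfl⟩ := h2.exists_smul_eq hx γ
    exact ⟨a • t, hcx a⟩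
  refine ⟨AddEquiv.ofBijective f ⟨hinj, hsurj⟩, fun n γ => ?_, hcx⟩
  change c (n • γ) • x = n • c γ • x
  rw [← NGroup.mul_smul]
  exact hwd _ _ (by rw [NGroup.mul_smul, hc, hc])

/-- Two elements of `Γ` are related if some `N`-automorphism maps the first to an element on which
every `n` acts as on the second. -/
def orbitSetoid (N Γ : Type*) [NearRing N] [AddGroup Γ] [NGroup N Γ] : Setoid Γ where
  r γ δ := ∃ s ∈ aut N Γ, ∀ n : N, s (n • γ) = n • δ
  iseqv :=
    { refl := fun _ => ⟨0, (aut N Γ).zero_mem, fun _ => rfl⟩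
      symm := by
        rintro γ δ ⟨s, hs, h⟩
        refine ⟨-s, (aut N Γ).neg_mem hs, fun n => ?_⟩
        change s.symm (n • δ) = n • γ
        rw [AddEquiv.symm_apply_eq, h]
      trans := by
        rintro α β γ ⟨s, hs, h⟩ ⟨t, ht, h'⟩
        refine ⟨t + s, (aut N Γ).add_mem ht hs, fun n => ?_⟩
        change t (s (n • α)) = n • γ
        rw [h, h'] }

/-- An `N`-group of type 2 has a choice `φ` of representatives of its indistinguishability classes
that commutes with all `N`-automorphisms and picks `0` in the class of `0`. -/
theorem exists_equivariant_representative (hzs : NearRing.IsZeroSymmetric N)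
    (h2 : IsTypeTwo N Γ) :
    ∃ φ : Γ → Γ, (∀ γ, (∀ n : N, n • γ = 0) → φ γ = 0) ∧ (∀ (n : N) γ, n • φ γ = n • γ) ∧
      (∀ γ δ, (∀ n : N, n • γ = n • δ) → φ γ = φ δ) ∧ ∀ s ∈ aut N Γ, ∀ γ, φ (s γ) = s (φ γ) := by
  classical
  let r : Γ → Γ := fun γ => (Quotient.mk (orbitSetoid N Γ) γ).out
  have hr : ∀ γ, ∃ s ∈ aut N Γ, ∀ n : N, s (n • r γ) = n • γ := fun γ =>
    Quotient.mk_out (s := orbitSetoid N Γ) γ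
  have hr_eq : ∀ γ δ, (∃ s ∈ aut N Γ, ∀ n : N, s (n • γ) = n • δ) → r γ = r δ := fun γ δ h =>
    congrArg Quotient.out (Quotient.sound (s := orbitSetoid N Γ) h)
  choose s hs hsr using hr
  have hr_ne : ∀ γ, (¬ ∀ n : N, n • γ = 0) → ∃ n : N, n • r γ ≠ 0 := fun γ hγ => by
    by_contra! h
    exact hγ fun n => by rw [← hsr, h, map_zero]
  have hcompat : ∀ t ∈ aut N Γ, ∀ γ δ, (∀ n : N, t (n • γ) = n • δ) →
      (if ∀ n : N, n • δ = 0 then (0 : Γ) else s δ (r δ)) =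
        t (if ∀ n : N, n • γ = 0 then 0 else s γ (r γ)) := by
    intro t ht γ δ h
    have hiff : (∀ n : N, n • δ = 0) ↔ ∀ n : N, n • γ = 0 :=
      forall_congr' fun n => by rw [← h, map_eq_zero_iff t t.injective]
    by_cases h0 : ∀ n : N, n • γ = 0
    · rw [if_pos h0, if_pos (hiff.mpr h0), map_zero]
    · rw [if_neg h0, if_neg (mt hiff.mp h0)]
      have hrr : r γ = r δ := hr_eq γ δ ⟨t, ht, h⟩
      have : s δ = t + s γ := h2.aut_eq (hr_ne γ h0) fun n => by
        change _ = t (s γ (n • r γ))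
        rw [hsr, h, hrr, hsr]
      rw [this, hrr]
      rfl
  refine ⟨fun γ => if ∀ n : N, n • γ = 0 then 0 else s γ (r γ), fun γ hγ => if_pos hγ,
    fun n γ => ?_, fun γ δ h => ?_, fun t ht γ => hcompat t ht γ _ fun n => ht n γ⟩
  · by_cases h0 : ∀ n : N, n • γ = 0
    · simp only [if_pos h0, h0 n, smul_zero_eq hzs]
    · simp only [if_neg h0]
      rw [← hs γ, hsr]
  · exact (hcompat 0 (aut N Γ).zero_mem γ δ h).symm

end NGroup

namespace SandwichData

variable {Γ : Type*} [AddGroup Γ]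

/-! ### From a sandwich centralizer near-ring to a 2-primitive one -/

/-- Since `S` acts freely, an element of the sandwich centralizer near-ring may take any value at a
given nonzero point of `X`. -/
theorem exists_apply_eq (D : SandwichData Γ) (x : D.X) (hx : (x : Γ) ≠ 0)
    (hfix : ∀ s ∈ D.S, s (x : Γ) = x → s = AddEquiv.refl Γ) (γ : Γ) :
    ∃ g : D.CentralizerNearRing, g x = γ := by
  classical
  have huniq : ∀ s ∈ D.S, ∀ t ∈ D.S, s (x : Γ) = t x → s = t := fun s hs t ht h => by
    have h1 := hfix (-t + s) (D.S.add_mem (D.S.neg_mem ht) hs)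
      (by change t.symm (s x) = x; rw [h, AddEquiv.symm_apply_apply])
    exact (neg_add_eq_zero.mp h1).symm
  let F : D.X → Γ := fun y =>
    if h : ∃ s ∈ D.S, s (x : Γ) = y then h.choose γ else 0
  have hF : ∀ (s : AddAut Γ), s ∈ D.S → ∀ y : D.X, s (x : Γ) = y → F y = s γ := by
    intro s hs y hy
    have h : ∃ s ∈ D.S, s (x : Γ) = y := ⟨s, hs, hy⟩
    have : h.choose = s := huniq _ h.choose_spec.1 _ hs (h.choose_spec.2.trans hy.symm)
    simp only [F, dif_pos h, this]
  refine ⟨⟨F, dif_neg ?_, fun s hs y => ?_⟩, hF 0 D.S.zero_mem x rfl⟩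
  · rintro ⟨s, -, h⟩
    exact hx ((map_eq_zero_iff s s.injective).mp h)
  · by_cases h : ∃ t ∈ D.S, t (x : Γ) = y
    · obtain ⟨t, ht, hty⟩ := h
      rw [hF t ht y hty, hF (s + t) (D.S.add_mem hs ht) ⟨s y, _⟩ (congrArg s hty)]
      rfl
    · have h' : ¬ ∃ t ∈ D.S, t (x : Γ) = s y := by
        rintro ⟨t, ht, hty⟩
        refine h ⟨-s + t, D.S.add_mem (D.S.neg_mem hs) ht, ?_⟩
        change s.symm (t x) = y
        rw [hty, AddEquiv.symm_apply_apply]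
      simp only [F, dif_neg h, dif_neg h', map_zero]

/-- The inclusion of `X` into `Γ`, as an element of the sandwich centralizer near-ring. -/
def inclusion (D : SandwichData Γ) : D.CentralizerNearRing where
  toFun x := x
  map_zero' := rfl
  map_S' _ _ _ := rfl

theorem isTwoPrimitive_of_dense {N Γ : Type u} [NearRing N] [AddGroup Γ] (D : SandwichData Γ)
    (hX : ∃ x ∈ D.X, x ≠ 0) (hfix : D.ActsWithoutFixedPointsOn {x ∈ D.X | x ≠ 0})
    (hφ : ∀ x : D.X, D.φ x.1 = x) (M : SubNearRing D.CentralizerNearRing) (hM : D.IsDense M)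
    (e : N ≃+* M.toAddSubgroup)
    (hker : ∀ K : AddSubgroup Γ, (K : Set Γ) ⊆ D.kernelSet → K = ⊥) :
    NearRing.IsTwoPrimitive N := by
  have hM1 : ∀ (x : D.X) (g : D.CentralizerNearRing), ∃ n : N, (e n).1 x = g x := fun x g => by
    obtain ⟨f, hf, h⟩ := hM 1 (fun _ => x) g
    exact ⟨e.symm ⟨f, hf⟩, by rw [e.apply_symm_apply]; exact h 0⟩
  let act : NGroup N Γ :=
    { smul := fun n γ => (e n).1 (D.φ γ)
      add_smul := fun m n γ => by
        change (e (m + n)).1 (D.φ γ) = (e m).1 (D.φ γ) + (e n).1 (D.φ γ)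
        rw [map_add]
        rfl
      mul_smul := fun m n γ => by
        change (e (m * n)).1 (D.φ γ) = (e m).1 (D.φ ((e n).1 (D.φ γ)))
        rw [map_mul]
        rfl }
  refine ⟨Γ, inferInstance, act, fun n hn => ?_, ?_, fun K hK => ?_⟩
  · have h0 : e n = 0 := Subtype.ext (CentralizerNearRing.ext (funext fun x => by
      have := hn x.1
      change (e n).1 (D.φ x.1) = 0 at this
      rw [hφ] at this
      exact this))
    exact e.injective (h0.trans (map_zero (e : N →+ M.toAddSubgroup)).symm)
  · obtain ⟨x, hx, hx0⟩ := hX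
    obtain ⟨n, hn⟩ := hM1 ⟨x, hx⟩ D.inclusion
    refine ⟨n, x, ?_⟩
    change (e n).1 (D.φ x) ≠ 0
    rw [hφ ⟨x, hx⟩, hn]
    exact hx0
  · refine or_iff_not_imp_left.mpr fun hne => ?_
    have : ¬ (K : Set Γ) ⊆ D.kernelSet := mt (hker K) hne
    obtain ⟨k, hk, hk0⟩ := Set.not_subset.mp this
    refine (AddSubgroup.eq_top_iff' K).mpr fun γ => ?_
    obtain ⟨g, hg⟩ := D.exists_apply_eq (D.φ k) hk0
      (fun s hs h => hfix s hs _ ⟨(D.φ k).2, hk0⟩ h) γ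
    obtain ⟨n, hn⟩ := hM1 (D.φ k) g
    have hmem := hK n k hk
    change (e n).1 (D.φ k) ∈ K at hmem
    rwa [hn, hg] at hmem

end SandwichData

namespace NGroup

variable {N Γ : Type*} [NearRing N] [AddGroup Γ] [NGroup N Γ]

/-! ### From a 2-primitive near-ring to a sandwich centralizer near-ring -/

/-- The sandwich data with `S` the group of all `N`-automorphisms and `X` the image of an
idempotent `φ` that commutes with them. -/
def sandwichData (N : Type*) {Γ : Type*} [NearRing N] [AddGroup Γ] [NGroup N Γ] (φ : Γ → Γ)
    (hφ0 : φ 0 = 0) (hφφ : ∀ γ, φ (φ γ) = φ γ) (hφs : ∀ s ∈ aut N Γ, ∀ γ, φ (s γ) = s (φ γ)) :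
    SandwichData Γ where
  X := {x | φ x = x}
  φ γ := ⟨φ γ, hφφ γ⟩
  S := aut N Γ
  zero_mem := hφ0
  φ_zero := hφ0
  S_mem _ hs x hx := (hφs _ hs x).trans (congrArg _ hx)
  φ_comm := hφs

/-- An element `n` of `N` as the function `x ↦ n • x`, in a sandwich centralizer near-ring whose
automorphisms commute with `N`. -/
def toCentralizer (hzs : NearRing.IsZeroSymmetric N) (D : SandwichData Γ)
    (hS : D.S ≤ aut N Γ) (n : N) : D.CentralizerNearRing where
  toFun x := n • (x : Γ)
  map_zero' := smul_zero_eq hzs n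
  map_S' _ hs x := (hS hs n x).symm

/-- The functions `x ↦ n • x` form a subnear-ring, provided that every `n` acts equally on `γ` and
`φ γ`. -/
def centralizerRange (hzs : NearRing.IsZeroSymmetric N) (D : SandwichData Γ)
    (hS : D.S ≤ aut N Γ) (hφ : ∀ (n : N) (γ : Γ), n • (D.φ γ : Γ) = n • γ) :
    SubNearRing D.CentralizerNearRing where
  carrier := Set.range (toCentralizer hzs D hS)
  zero_mem' := ⟨0, SandwichData.CentralizerNearRing.ext (funext fun x => zero_smul_eq (x : Γ))⟩
  add_mem' := by
    rintro _ _ ⟨m, rfl⟩ ⟨n, rfl⟩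
    exact ⟨m + n, SandwichData.CentralizerNearRing.ext
      (funext fun x => NGroup.add_smul m n (x : Γ))⟩
  neg_mem' := by
    rintro _ ⟨n, rfl⟩
    exact ⟨-n, SandwichData.CentralizerNearRing.ext (funext fun x => neg_smul_eq n (x : Γ))⟩
  mul_mem' := by
    rintro _ _ ⟨m, rfl⟩ ⟨n, rfl⟩
    exact ⟨m * n, SandwichData.CentralizerNearRing.ext
      (funext fun x => (NGroup.mul_smul m n (x : Γ)).trans (hφ m _).symm)⟩

theorem nonempty_ringEquiv_centralizerRange (hzs : NearRing.IsZeroSymmetric N)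
    (hf : IsFaithful N Γ) (D : SandwichData Γ) (hS : D.S ≤ aut N Γ)
    (hφ : ∀ (n : N) (γ : Γ), n • (D.φ γ : Γ) = n • γ) :
    Nonempty (N ≃+* (centralizerRange hzs D hS hφ).toAddSubgroup) := by
  let F : N → (centralizerRange hzs D hS hφ).toAddSubgroup := fun n =>
    ⟨toCentralizer hzs D hS n, n, rfl⟩
  have hF : Function.Bijective F := by
    refine ⟨fun m n h => hf.eq_of_smul_eq fun γ => ?_, ?_⟩
    · have h' : toCentralizer hzs D hS m (D.φ γ) = toCentralizer hzs D hS n (D.φ γ) :=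
        congrArg (fun f => f.1 (D.φ γ)) h
      exact (hφ m γ).symm.trans (h'.trans (hφ n γ))
    · rintro ⟨_, n, rfl⟩
      exact ⟨n, rfl⟩
  exact ⟨{ Equiv.ofBijective F hF with
    map_mul' := fun m n => Subtype.ext (SandwichData.CentralizerNearRing.ext
      (funext fun x => (NGroup.mul_smul m n (x : Γ)).trans (hφ m _).symm))
    map_add' := fun m n => Subtype.ext (SandwichData.CentralizerNearRing.ext
      (funext fun x => NGroup.add_smul m n (x : Γ))) }⟩

/-- The density theorem: on finitely many points of `X`, every function in the sandwich centralizer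
near-ring is given by an element of `N`. -/
theorem exists_smul_eq_on_finset (hzs : NearRing.IsZeroSymmetric N) (hnr : ¬ NearRing.IsRing N)
    (hf : IsFaithful N Γ) (h2 : IsTypeTwo N Γ) (D : SandwichData Γ) (hS : D.S = aut N Γ)
    (hφX : ∀ x : D.X, D.φ x.1 = x) (hφ0 : ∀ γ : Γ, (∀ n : N, n • γ = 0) → (D.φ γ : Γ) = 0)
    (hφeq : ∀ γ δ : Γ, (∀ n : N, n • γ = n • δ) → D.φ γ = D.φ δ)
    (g : D.CentralizerNearRing) (T : Finset D.X) :
    ∃ n : N, ∀ x ∈ T, n • (x : Γ) = g x := by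
  classical
  induction T using Finset.induction_on with
  | empty => exact ⟨0, fun x hx => by simp at hx⟩
  | insert x T _ ih =>
    obtain ⟨n, hn⟩ := ih
    by_cases hx : ∃ a : N, a • (x : Γ) ≠ 0
    · by_cases hT : ∀ t ∈ T, ∃ a : N, a • (t : Γ) = 0 ∧ a • (x : Γ) ≠ 0
      · obtain ⟨a, ha, hax⟩ := exists_ann_finset_smul_ne_zero hzs hnr hf h2 hx
          (T.image Subtype.val) (fun t ht => by
            obtain ⟨u, hu, rfl⟩ := Finset.mem_image.mp ht
            exact hT u hu)
        obtain ⟨b, hb, hbx⟩ := h2.exists_mem_smul_eq _ (mul_mem_ann hzs _) ⟨a, ha, hax⟩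
          (g x + -(n • (x : Γ)))
        refine ⟨b + n, fun y hy => ?_⟩
        rw [NGroup.add_smul]
        rcases Finset.mem_insert.mp hy with rfl | hy
        · rw [hbx, neg_add_cancel_right]
        · rw [hb y (Finset.mem_coe.mpr (Finset.mem_image_of_mem _ hy)), zero_add, hn y hy]
      · -- Here `x` lies in the `S`-orbit of some `t ∈ T`, so nothing has to be changed.
        push Not at hT
        obtain ⟨t, ht, hann⟩ := hT
        obtain ⟨s, hs, hst⟩ := exists_aut_of_ann_le hzs h2 hx hann
        have hsS : s ∈ D.S := hS ▸ hs
        have hxt : x = ⟨s t, D.S_mem s hsS t t.2⟩ := by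
          rw [← hφX x, ← hφX ⟨s t, _⟩]
          exact hφeq _ _ fun m => by rw [← hst, hs]
        refine ⟨n, fun y hy => ?_⟩
        rcases Finset.mem_insert.mp hy with rfl | hy
        · rw [← hst, hn t ht, ← g.map_S' s hsS t, ← hxt]
        · exact hn y hy
    · push Not at hx
      have hx0 : x = ⟨0, D.zero_mem⟩ := Subtype.ext
        ((congrArg Subtype.val (hφX x)).symm.trans (hφ0 x hx))
      refine ⟨n, fun y hy => ?_⟩
      rcases Finset.mem_insert.mp hy with rfl | hy
      · rw [hx, hx0, g.map_zero']
      · exact hn y hy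

end NGroup

theorem theorem4p4 {N : Type u} [NearRing N] (hzs : NearRing.IsZeroSymmetric N)
    (hnr : ¬ NearRing.IsRing N) :
    NearRing.IsTwoPrimitive N ↔
      ∃ (Γ : Type u) (_ : AddGroup Γ) (D : SandwichData Γ) (X₁ : Set Γ),
        D.X = {0} ∪ X₁ ∧ X₁.Nonempty ∧ (0 : Γ) ∉ X₁ ∧
        D.ActsWithoutFixedPointsOn X₁ ∧
        (∀ x : D.X, D.φ x.1 = x) ∧
        (∃ M : SubNearRing D.CentralizerNearRing,
          D.IsDense M ∧ Nonempty (N ≃+* M.toAddSubgroup)) ∧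
        ∀ K : AddSubgroup Γ, (K : Set Γ) ⊆ D.kernelSet → K = ⊥ := by
  classical
  constructor
  · rintro ⟨Γ, _, _, hf, h2⟩
    obtain ⟨φ, hφ0, hφn, hφeq, hφs⟩ := NGroup.exists_equivariant_representative hzs h2
    have hφφ : ∀ γ, φ (φ γ) = φ γ := fun γ => hφeq _ _ fun n => hφn n γ
    let D : SandwichData Γ := NGroup.sandwichData N φ
      (hφ0 0 fun n => NGroup.smul_zero_eq hzs n) hφφ hφs
    have hφX : ∀ x : D.X, D.φ x.1 = x := fun x => Subtype.ext x.2
    -- A point of `X` that is annihilated by `N` is `0`.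
    have hne : ∀ x ∈ D.X, x ≠ 0 → ∃ n : N, n • x ≠ 0 := fun x hx hx0 => by
      by_contra! h
      exact hx0 ((show φ x = x from hx).symm.trans (hφ0 x h))
    refine ⟨Γ, inferInstance, D, {x ∈ D.X | x ≠ 0}, ?_, ?_, fun h => h.2 rfl, ?_, hφX,
      ⟨NGroup.centralizerRange hzs D le_rfl hφn, ?_,
        NGroup.nonempty_ringEquiv_centralizerRange hzs hf D le_rfl hφn⟩, ?_⟩
    · ext x
      by_cases hx : x = 0
      · simp [hx, D.zero_mem]
      · simp [hx]
    · obtain ⟨n, γ, hn⟩ := h2.1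
      refine ⟨φ γ, hφφ γ, fun h => hn ?_⟩
      rw [← hφn, h, NGroup.smul_zero_eq hzs]
    · rintro s hs x ⟨hx, hx0⟩ hsx
      refine h2.aut_eq (hne x hx hx0) fun n => ?_
      rw [show s (n • x) = n • s x from hs n x, hsx]
      rfl
    · intro k x g
      obtain ⟨n, hn⟩ := NGroup.exists_smul_eq_on_finset hzs hnr hf h2 D rfl hφX hφ0
        (fun γ δ h => Subtype.ext (hφeq γ δ h)) g (Finset.univ.image x)
      exact ⟨_, ⟨n, rfl⟩, fun i => hn _ (Finset.mem_image_of_mem x (Finset.mem_univ i))⟩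
    · intro K hK
      -- The elements of `kernelSet` are annihilated by `N`, so `K` is an `N`-subgroup.
      have hK0 : ∀ (n : N), ∀ k ∈ K, n • k = 0 := fun n k hk => by
        rw [← hφn, show φ k = 0 from hK hk, NGroup.smul_zero_eq hzs]
      refine (h2.2 K fun n k hk => by rw [hK0 n k hk]; exact K.zero_mem).resolve_right fun h => ?_
      obtain ⟨n, γ, hn⟩ := h2.1
      exact hn (hK0 n γ (h ▸ AddSubgroup.mem_top γ))
  · rintro ⟨Γ, _, D, X₁, hX, ⟨x, hx⟩, h0, hfix, hφ, ⟨M, hM, ⟨e⟩⟩, hker⟩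
    refine D.isTwoPrimitive_of_dense ⟨x, hX ▸ Or.inr hx, fun h => h0 (h ▸ hx)⟩
      (fun s hs y hy => hfix s hs y ?_) hφ M hM e hker
    have hyX : y ∈ ({0} ∪ X₁ : Set Γ) := hX ▸ hy.1
    exact hyX.resolve_left hy.2
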